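/- Let $k$ be a field, $S = k[[x,y,z]]$ and $R = S/(z^2-xy)$, and let $M$ be the cokernel of the map $$d_1\colon R^4 \xrightarrow{\ \begin{pmatrix} x & 0 & z & y\\ y & x & y & 0\end{pmatrix}\ } R^2 .$$ Then $M$ is an $R$-module of finite length and of projective dimension $2$, and the following hold. 1. $M$ is Serre liftable to $S$: the ring $S$ is a regular local ring, and there is a finitely generated $S$-module $L$ with $L\otimes_S R\cong M$ as $R$-modules and $\dim S-\dim L=\dim R-\dim M$ (Krull dimensions). 2. $M$ does not lift to any regular local ring: for every regular local ring $Q$ and every surjective ring homomorphism $Q\to R$, there is no $Q$-module $L$ such that $L\otimes_Q R\cong M$ as $R$-modules and $\operatorname{Tor}_i^Q(L,R)=0$ for all $i>0$. -/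

import Mathlib

open scoped TensorProduct

universe u

namespace SerreLifting

/-! ### Lifts and Serre lifts along a surjection `Q → R`, given as an algebra structure -/

section Lifts

variable (Q R L M : Type u) [CommRing Q] [CommRing R] [Algebra Q R]
  [AddCommGroup L] [Module Q L] [AddCommGroup M] [Module R M]

/-- The `Q`-module `L` is a lift of the `R`-module `M`: `L ⊗_Q R ≅ M` as `R`-modules and
`Tor_i^Q(L, R) = 0` for all `i > 0`. -/
def IsLift : Prop :=
  Nonempty ((R ⊗[Q] L) ≃ₗ[R] M) ∧
    ∀ i : ℕ, 0 < i → CategoryTheory.Limits.IsZero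
      (((CategoryTheory.Tor (ModuleCat.{u} Q) i).obj (ModuleCat.of Q L)).obj (ModuleCat.of Q R))

/-- The finitely generated `Q`-module `L` is a Serre lift of the `R`-module `M`:
`L ⊗_Q R ≅ M` and `dim Q - dim L = dim R - dim M`. The equality is written without subtraction;
over noetherian local rings and for `M ≠ 0` all four dimensions are natural numbers. -/
def IsSerreLift : Prop :=
  Module.Finite Q L ∧ Nonempty ((R ⊗[Q] L) ≃ₗ[R] M) ∧
    ringKrullDim Q + Module.supportDim R M = ringKrullDim R + Module.supportDim Q L

end Lifts

section Liftable

variable (Q R M : Type u) [CommRing Q] [CommRing R] [Algebra Q R]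
  [AddCommGroup M] [Module R M]

/-- The `R`-module `M` lifts to `Q`. -/
def IsLiftable : Prop :=
  ∃ (L : Type u) (_ : AddCommGroup L) (_ : Module Q L), IsLift Q R L M

/-- The `R`-module `M` is Serre liftable to `Q`, which has to be a regular local ring that
surjects onto `R`. -/
def IsSerreLiftable : Prop :=
  IsRegularLocalRing Q ∧ Function.Surjective (algebraMap Q R) ∧
    ∃ (L : Type u) (_ : AddCommGroup L) (_ : Module Q L), IsSerreLift Q R L M

end Liftable

/-! ### The ring and the module -/

section Objects

variable (k : Type u) [Field k]

/-- `k[[x, y, z]]`, the variables `x, y, z` being `X 0, X 1, X 2`. -/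
abbrev S : Type u := MvPowerSeries (Fin 3) k

/-- `R = k[[x, y, z]] / (z² - xy)`. -/
abbrev R : Type u :=
  S k ⧸ Ideal.span {(MvPowerSeries.X 2 ^ 2 - MvPowerSeries.X 0 * MvPowerSeries.X 1 : S k)}

/-- The image in `R` of the `i`-th variable. -/
noncomputable def var (i : Fin 3) : R k := algebraMap (S k) (R k) (MvPowerSeries.X i)

/-- The matrix of `d₁ : R⁴ → R²`. -/
noncomputable def d₁ : Matrix (Fin 2) (Fin 4) (R k) :=
  !![var k 0, 0, var k 2, var k 1;
     var k 1, var k 0, var k 1, 0]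

/-- The module `M`, the cokernel of `d₁ : R⁴ → R²`. -/
abbrev M : Type u := (Fin 2 → R k) ⧸ LinearMap.range (d₁ k).mulVecLin

end Objects

end SerreLifting

/-! Non-liftability: let Q → R be surjective with Q regular local, I its kernel, 𝔪 the maximal ideal
of Q, and L a lift of M. Vanishing of Tor₁ makes L ⊗ I → L injective. Lift x, y, z to Q and the
basis vectors to e₁, e₂ in L. The columns of `d₁` then give elements of L ⊗ I. Their syzygy (-z, -y,
x + z, -x) holds over Q only up to f = z² - xy, so it writes e₁ ⊗ f as an 𝔪-combination of these
elements. A functional to the residue field with e₁ ↦ 1 turns this into f ∈ 𝔪I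
(`sq_sub_mul_mem_of_relations`). By a height count in Q this forces z ∈ I + (x, y) + 𝔪²
(`IsRegularLocalRing.mem_of_sq_sub_mul_mem`), which fails in R because f has order two
(`var_two_notMem`).

Over R, the matrices `syzygies` and `presentation` form a minimal free resolution 0 → R² → R⁴ → R²
of M, whence projective dimension 2. Finite length holds because x², y² and z² = xy kill M. The
Serre lift is the cokernel of the same matrix over S; its support is V(x, y), of dimension 1, and 3
+ 0 = 2 + 1. -/

/-! ### Power series rings: ideals generated by variables, regularity, dimension. -/

namespace MvPowerSeries

variable {σ A : Type*} [CommRing A]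

/-- A power series lies in the ideal generated by a finite set of variables if and only if its
coefficients at all monomials prime to these variables vanish. -/
theorem mem_span_X_image_iff (T : Finset σ) (φ : MvPowerSeries σ A) :
    φ ∈ Ideal.span ((X : σ → MvPowerSeries σ A) '' T) ↔
      ∀ m : σ →₀ ℕ, (∀ t ∈ T, m t = 0) → coeff m φ = 0 := by
  classical
  induction T using Finset.induction_on generalizing φ with
  | empty =>
    simp [MvPowerSeries.ext_iff]
  | insert s T _ ih =>
    rw [Finset.coe_insert, Set.image_insert_eq, Ideal.span_insert, Submodule.mem_sup]
    constructor
    · rintro ⟨a, ha, b, hb, rfl⟩ m hm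
      rw [map_add, X_dvd_iff.mp (Ideal.mem_span_singleton.mp ha) m (hm s (by simp)),
        (ih b).mp hb m fun t ht ↦ hm t (by simp [ht]), add_zero]
    · intro h
      let φ₀ : MvPowerSeries σ A := fun m ↦ if m s = 0 then coeff m φ else 0
      have hφ₀ (m : σ →₀ ℕ) : coeff m φ₀ = if m s = 0 then coeff m φ else 0 := rfl
      refine ⟨φ - φ₀, Ideal.mem_span_singleton.mpr (X_dvd_iff.mpr fun m hm ↦ ?_), φ₀,
        (ih φ₀).mpr fun m hm ↦ ?_, sub_add_cancel _ _⟩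
      · simp [hφ₀, hm]
      · rw [hφ₀]
        split_ifs with hs
        · exact h m fun t ht ↦ by
            obtain rfl | ht := Finset.mem_insert.mp ht
            exacts [hs, hm t ht]
        · rfl

theorem coeff_add_single_X_mul (t : σ) (m : σ →₀ ℕ) (φ : MvPowerSeries σ A) :
    coeff (Finsupp.single t 1 + m) (X t * φ) = coeff m φ := by
  rw [X, coeff_add_monomial_mul, one_mul]

/-- A variable outside `T` is a nonzerodivisor modulo the variables in `T`. -/
theorem mem_span_X_image_of_X_mul_mem {T : Finset σ} {t : σ} (ht : t ∉ T)
    {φ : MvPowerSeries σ A}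
    (h : X t * φ ∈ Ideal.span ((X : σ → MvPowerSeries σ A) '' T)) :
    φ ∈ Ideal.span ((X : σ → MvPowerSeries σ A) '' T) := by
  classical
  rw [mem_span_X_image_iff] at h ⊢
  intro m hm
  rw [← coeff_add_single_X_mul t m]
  refine h _ fun s hs ↦ ?_
  have : t ≠ s := fun e ↦ ht (e ▸ hs)
  simp [hm s hs, this]

theorem maximalIdeal_eq_span_range_X {k : Type*} [Field k] [Finite σ] :
    IsLocalRing.maximalIdeal (MvPowerSeries σ k) = Ideal.span (Set.range X) := by
  classical
  have := Fintype.ofFinite σ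
  ext φ
  have h := mem_span_X_image_iff Finset.univ φ
  rw [Finset.coe_univ, Set.image_univ] at h
  rw [h, IsLocalRing.mem_maximalIdeal, mem_nonunits_iff, isUnit_iff_constantCoeff,
    isUnit_iff_ne_zero, not_not, ← coeff_zero_eq_constantCoeff_apply]
  refine ⟨fun h0 m hm ↦ ?_, fun hm ↦ hm 0 fun _ _ ↦ rfl⟩
  obtain rfl : m = 0 := Finsupp.ext fun t ↦ hm t (Finset.mem_univ t)
  exact h0

theorem natCast_le_ringKrullDim (k : Type*) [Field k] (n : ℕ) :
    (n : WithBot ℕ∞) ≤ ringKrullDim (MvPowerSeries (Fin n) k) := by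
  induction n with
  | zero => simpa using ringKrullDim_nonneg_of_nontrivial
  | succ n ih =>
    rw [ringKrullDim_eq_of_ringEquiv (finSuccEquiv k n).toRingEquiv, Nat.cast_succ]
    exact (add_le_add_left ih 1).trans ringKrullDim_succ_le_ringKrullDim_powerseries

theorem spanFinrank_maximalIdeal_le (k : Type*) [Field k] (n : ℕ) :
    (IsLocalRing.maximalIdeal (MvPowerSeries (Fin n) k)).spanFinrank ≤ n := by
  rw [maximalIdeal_eq_span_range_X]
  refine (Submodule.spanFinrank_span_le_ncard_of_finite (Set.finite_range _)).trans ?_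
  rw [← Set.image_univ]
  exact (Set.ncard_image_le Set.finite_univ).trans (by simp)

instance isRegularLocalRing_fin (k : Type*) [Field k] (n : ℕ) :
    IsRegularLocalRing (MvPowerSeries (Fin n) k) :=
  .of_spanFinrank_maximalIdeal_le _ <|
    (Nat.cast_le.mpr (spanFinrank_maximalIdeal_le k n)).trans (natCast_le_ringKrullDim k n)

theorem ringKrullDim_fin (k : Type*) [Field k] (n : ℕ) :
    ringKrullDim (MvPowerSeries (Fin n) k) = n :=
  le_antisymm ((ringKrullDim_le_spanFinrank_maximalIdeal _).trans
    (Nat.cast_le.mpr (spanFinrank_maximalIdeal_le k n))) (natCast_le_ringKrullDim k n)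

end MvPowerSeries

/-! ### Dimension and length read off from the annihilator. -/

namespace Module

variable {A N : Type*} [CommRing A] [AddCommGroup N] [Module A N]

theorem supportDim_le_ringKrullDim_quotient [Module.Finite A N] {J : Ideal A}
    (h : J ≤ (annihilator A N).radical) : supportDim A N ≤ ringKrullDim (A ⧸ J) := by
  have hle : support A N ⊆ PrimeSpectrum.zeroLocus (J : Set A) := by
    rw [support_eq_zeroLocus, ← PrimeSpectrum.zeroLocus_radical]
    exact PrimeSpectrum.zeroLocus_anti_mono h
  rw [ringKrullDim_quotient]
  exact Order.krullDim_le_of_strictMono (fun p ↦ ⟨p.1, hle p.2⟩) fun _ _ h ↦ h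

/-- N is finite over A / ann N, a noetherian local ring with nilpotent maximal ideal, hence
artinian. -/
theorem isFiniteLength_of_maximalIdeal_le_radical_annihilator [IsLocalRing A]
    [IsNoetherianRing A] [Module.Finite A N]
    (h : IsLocalRing.maximalIdeal A ≤ (annihilator A N).radical) : IsFiniteLength A N := by
  rw [isFiniteLength_iff_isNoetherian_isArtinian]
  refine ⟨inferInstance, ?_⟩
  nontriviality N
  have hne : annihilator A N ≠ ⊤ := by
    rw [Ne, annihilator_eq_top_iff]
    exact not_subsingleton N
  have : Nontrivial (A ⧸ annihilator A N) := Ideal.Quotient.nontrivial_iff.mpr hne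
  have : IsLocalRing (A ⧸ annihilator A N) :=
    .of_surjective' (Ideal.Quotient.mk _) Ideal.Quotient.mk_surjective
  have : IsArtinianRing (A ⧸ annihilator A N) := by
    rw [isArtinianRing_iff_isNilpotent_maximalIdeal,
      Ideal.FG.isNilpotent_iff_le_nilradical (IsNoetherian.noetherian _)]
    intro b hb
    obtain ⟨a, rfl⟩ := Ideal.Quotient.mk_surjective b
    obtain ⟨n, hn⟩ := h (show a ∈ IsLocalRing.maximalIdeal A from fun hu ↦ hb (hu.map _))
    exact ⟨n, by simpa [← map_pow] using Ideal.Quotient.eq_zero_iff_mem.mpr hn⟩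
  let _ : Module (A ⧸ annihilator A N) N := Module.quotientAnnihilator
  have : IsScalarTower A (A ⧸ annihilator A N) N :=
    Module.isTorsionBySet_annihilator A N |>.isScalarTower
  have : Module.Finite (A ⧸ annihilator A N) N := .of_restrictScalars_finite A _ _
  exact isArtinian_of_surjective_algebraMap (R := A ⧸ annihilator A N)
    Ideal.Quotient.mk_surjective

end Module

/-! ### From Tor₁(L, Q/I) = 0 to injectivity of L ⊗ I → L. -/

section Tor

variable {Q : Type*} [CommRing Q]

/-- If `P₂ → P₁ → P₀` is exact with `P₀` projective and `P₀ ⧸ im P₁ ≅ Q ⧸ I`, and stays exact at `P₁`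
after tensoring with `L`, then `L ⊗ I → L` is injective. -/
theorem Ideal.lTensor_subtype_injective_of_exact (I : Ideal Q)
    {L N P₀ P₁ P₂ : Type*} [AddCommGroup L] [Module Q L] [AddCommGroup N] [Module Q N]
    [AddCommGroup P₀] [Module Q P₀] [AddCommGroup P₁] [Module Q P₁] [AddCommGroup P₂] [Module Q P₂]
    [Module.Projective Q P₀] {q : Q →ₗ[Q] N} (hq : Function.Surjective q)
    (hI : LinearMap.ker q = I) {f₂ : P₂ →ₗ[Q] P₁} {f₁ : P₁ →ₗ[Q] P₀} {ε : P₀ →ₗ[Q] N}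
    (hε : Function.Surjective ε) (h₁ : Function.Exact f₂ f₁) (h₀ : Function.Exact f₁ ε)
    (hL : Function.Exact (f₂.lTensor L) (f₁.lTensor L)) :
    Function.Injective (I.subtype.lTensor L) := by
  let K := LinearMap.ker ε
  have hK (p : P₁) : f₁ p ∈ K := h₀.apply_apply_eq_zero p
  let g : P₁ →ₗ[Q] K := f₁.codRestrict K hK
  have hg : Function.Surjective g := fun ⟨p, hp⟩ ↦ by
    obtain ⟨p', rfl⟩ := (h₀ p).mp hp
    exact ⟨p', rfl⟩
  have hKinj : Function.Injective (K.subtype.lTensor L) := by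
    rw [injective_iff_map_eq_zero]
    intro t ht
    obtain ⟨s, rfl⟩ := LinearMap.lTensor_surjective L hg t
    rw [← LinearMap.comp_apply, ← LinearMap.lTensor_comp] at ht
    obtain ⟨r, rfl⟩ := (hL s).mp ht
    rw [← LinearMap.comp_apply, ← LinearMap.lTensor_comp]
    have : g ∘ₗ f₂ = 0 := LinearMap.ext fun r ↦ Subtype.ext (h₁.apply_apply_eq_zero r)
    rw [this, LinearMap.lTensor_zero, LinearMap.zero_apply]
  -- Compare P₀ → N with Q → N in both directions. The composite β ∘ α on Q is multiplication by
  -- some c ≡ 1 mod I, so c kills the kernel of L ⊗ I → L.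
  obtain ⟨α, hα⟩ := Module.projective_lifting_property ε q hε
  obtain ⟨β, hβ⟩ := Module.projective_lifting_property q ε hq
  have hαI (i : I) : α i ∈ K := by
    rw [LinearMap.mem_ker, ← LinearMap.comp_apply, hα, ← LinearMap.mem_ker, hI]
    exact i.2
  have hβK (x : K) : β x ∈ I := by
    rw [← hI, LinearMap.mem_ker, ← LinearMap.comp_apply, hβ]
    exact x.2
  let α' : I →ₗ[Q] K := (α ∘ₗ I.subtype).codRestrict K hαI
  let β' : K →ₗ[Q] I := (β ∘ₗ K.subtype).codRestrict I hβK
  let c : Q := β (α 1)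
  have hc : 1 - c ∈ I := by
    have : q (β (α 1)) = q 1 := by
      rw [← LinearMap.comp_apply, hβ, ← LinearMap.comp_apply, hα]
    rw [← hI, LinearMap.mem_ker, map_sub, sub_eq_zero, this]
  have hβα : β' ∘ₗ α' = c • LinearMap.id := by
    ext i
    change β (α i) = c * i
    rw [← mul_one (i : Q), ← smul_eq_mul, map_smul, map_smul]
    simp [c, mul_comm]
  rw [injective_iff_map_eq_zero]
  intro t ht
  have h0 : α'.lTensor L t = 0 := by
    refine hKinj ?_
    rw [map_zero, ← LinearMap.comp_apply, ← LinearMap.lTensor_comp]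
    have : K.subtype ∘ₗ α' = α ∘ₗ I.subtype := rfl
    rw [this, LinearMap.lTensor_comp, LinearMap.comp_apply, ht, map_zero]
  have hct : c • t = 0 := by
    have := congrArg (β'.lTensor L) h0
    rwa [map_zero, ← LinearMap.comp_apply, ← LinearMap.lTensor_comp, hβα, LinearMap.lTensor_smul,
      LinearMap.lTensor_id] at this
  -- Since i • (l ⊗ j) = (j • l) ⊗ i, the product i • t depends only on the image of t in L. Hence
  -- I, and in particular 1 - c, also kills that kernel.
  have hmul (i : I) (t : L ⊗[Q] I) :
      (i : Q) • t = (TensorProduct.mk Q L I).flip i (TensorProduct.rid Q L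
        (I.subtype.lTensor L t)) := by
    induction t with
    | zero => simp
    | add x y hx hy => rw [smul_add, hx, hy, map_add, map_add, map_add]
    | tmul l j =>
      have : (i : Q) • j = (j : Q) • i := Subtype.ext (mul_comm _ _)
      simp [this, ← TensorProduct.tmul_smul]
  have h1 := hmul ⟨1 - c, hc⟩ t
  rw [ht, map_zero, map_zero, sub_smul, hct, one_smul, sub_zero] at h1
  exact h1

end Tor

section TorFunctor

open CategoryTheory

variable {Q : Type u} [CommRing Q]

/-- `Tor` is computed from a chosen projective resolution of N, whose term in degree 0 need not be
Q; this is why the previous lemma allows an arbitrary P₀. -/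
theorem Ideal.lTensor_subtype_injective_of_isZero_tor (I : Ideal Q) {L N : Type u}
    [AddCommGroup L] [Module Q L] [AddCommGroup N] [Module Q N]
    {q : Q →ₗ[Q] N} (hq : Function.Surjective q) (hI : LinearMap.ker q = I)
    (h : Limits.IsZero (((Tor (ModuleCat.{u} Q) 1).obj (ModuleCat.of Q L)).obj
      (ModuleCat.of Q N))) :
    Function.Injective (I.subtype.lTensor L) := by
  let P := projectiveResolution (ModuleCat.of Q N)
  let F := (MonoidalCategory.tensoringLeft (ModuleCat.{u} Q)).obj (ModuleCat.of Q L)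
  have hz := h.of_iso (P.isoLeftDerivedObj F 1).symm
  have hex : (((F.mapHomologicalComplex _).obj P.complex).sc' 2 1 0).Exact := by
    rw [← HomologicalComplex.exactAt_iff' _ 2 1 0 (by simp) (by simp)]
    exact (HomologicalComplex.exactAt_iff_isZero_homology _ _).mpr hz
  have hex1 := P.exact_succ 0
  have hex0 := P.exact₀
  rw [ShortComplex.moduleCat_exact_iff] at hex hex1 hex0
  have hproj : Module.Projective Q (P.complex.X 0) :=
    (IsProjective.iff_projective (P.complex.X 0)).mpr (P.projective 0)
  have hepi : Epi (P.π.f 0) := inferInstance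
  refine I.lTensor_subtype_injective_of_exact hq hI (f₂ := (P.complex.d 2 1).hom)
    (f₁ := (P.complex.d 1 0).hom) (ε := (P.π.f 0).hom)
    ((ModuleCat.epi_iff_surjective _).mp hepi) ?_ ?_ ?_
  · intro x
    refine ⟨fun hx ↦ hex1 x hx, ?_⟩
    rintro ⟨y, rfl⟩
    rw [← LinearMap.comp_apply, ← ModuleCat.hom_comp, P.complex.d_comp_d]
    rfl
  · intro x
    refine ⟨fun hx ↦ hex0 x hx, ?_⟩
    rintro ⟨y, rfl⟩
    exact congrArg (fun g ↦ g.hom y) P.complex_d_comp_π_f_zero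
  · intro x
    refine ⟨fun hx ↦ hex x hx, ?_⟩
    rintro ⟨y, rfl⟩
    rw [← LinearMap.comp_apply, ← LinearMap.lTensor_comp, ← ModuleCat.hom_comp,
      P.complex.d_comp_d]
    simp

end TorFunctor

/-! ### The obstruction: f lies in 𝔪I. -/

section Obstruction

variable {Q : Type*} [CommRing Q]

theorem TensorProduct.exists_lTensor_subtype_eq_of_tmul_eq_zero {I : Ideal Q} {L A : Type*}
    [AddCommGroup L] [Module Q L] [CommRing A] [Algebra Q A]
    (hq : Function.Surjective (algebraMap Q A)) (hI : RingHom.ker (algebraMap Q A) = I)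
    {l : L} (hl : (1 : A) ⊗ₜ[Q] l = 0) :
    ∃ t : L ⊗[Q] I, TensorProduct.rid Q L (I.subtype.lTensor L t) = l := by
  have hex : Function.Exact I.subtype (Algebra.linearMap Q A) := by
    intro x
    rw [Algebra.linearMap_apply, ← RingHom.mem_ker, hI]
    simp
  have h : (Algebra.linearMap Q A).lTensor L (l ⊗ₜ[Q] (1 : Q)) = 0 := by
    have := congrArg (TensorProduct.comm Q A L) hl
    simpa using this
  obtain ⟨t, ht⟩ := (lTensor_exact L hex hq _).mp h
  exact ⟨t, by rw [ht]; simp⟩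

theorem TensorProduct.smul_eq_zero_of_mem_ker {κ N : Type*} [CommRing κ] [Algebra Q κ]
    [AddCommGroup N] [Module Q N] {a : Q} (ha : algebraMap Q κ a = 0) (t : κ ⊗[Q] N) :
    a • t = 0 := by
  induction t with
  | zero => simp
  | add x y hx hy => rw [smul_add, hx, hy, add_zero]
  | tmul c n =>
    rw [TensorProduct.smul_tmul', _root_.Algebra.smul_def, ha, zero_mul, TensorProduct.zero_tmul]

/-- For 𝔫 the kernel of Q → κ, κ ⊗ I is I/𝔫I. -/
theorem TensorProduct.mem_ker_mul_of_one_tmul_eq_zero {κ : Type*} [CommRing κ] [Algebra Q κ]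
    (hκ : Function.Surjective (algebraMap Q κ)) {I : Ideal Q} {f : I}
    (hf : (1 : κ) ⊗ₜ[Q] f = 0) : (f : Q) ∈ RingHom.ker (algebraMap Q κ) * I := by
  obtain ⟨t, ht⟩ := exists_lTensor_subtype_eq_of_tmul_eq_zero hκ rfl hf
  rw [← ht]
  clear ht hf
  induction t with
  | zero => simp
  | add x y hx hy => simpa using add_mem hx hy
  | tmul i j =>
    simpa [mul_comm] using Ideal.mul_mem_mul j.2 i.2

/-- Lifting the relations `x e₁ + y e₂ = x e₂ = z e₁ + y e₂ = y e₁ = 0` of a quotient of `L` to `L`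
itself forces `z² - xy` to be a non-minimal generator of the ideal. -/
theorem sq_sub_mul_mem_of_relations {I : Ideal Q} {L A κ : Type*}
    [AddCommGroup L] [Module Q L] (hinj : Function.Injective (I.subtype.lTensor L))
    [CommRing A] [Algebra Q A] (hq : Function.Surjective (algebraMap Q A))
    (hI : RingHom.ker (algebraMap Q A) = I) [CommRing κ] [Algebra Q κ]
    (hκ : Function.Surjective (algebraMap Q κ)) (φ : L →ₗ[Q] κ) {e₁ e₂ : L} (hφ : φ e₁ = 1)
    {x y z : Q} (hx : algebraMap Q κ x = 0) (hy : algebraMap Q κ y = 0)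
    (hz : algebraMap Q κ z = 0) (hf : z ^ 2 - x * y ∈ I)
    (h₁ : (1 : A) ⊗ₜ[Q] (x • e₁ + y • e₂) = 0) (h₂ : (1 : A) ⊗ₜ[Q] (x • e₂) = 0)
    (h₃ : (1 : A) ⊗ₜ[Q] (z • e₁ + y • e₂) = 0) (h₄ : (1 : A) ⊗ₜ[Q] (y • e₁) = 0) :
    z ^ 2 - x * y ∈ RingHom.ker (algebraMap Q κ) * I := by
  obtain ⟨t₁, ht₁⟩ := TensorProduct.exists_lTensor_subtype_eq_of_tmul_eq_zero hq hI h₁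
  obtain ⟨t₂, ht₂⟩ := TensorProduct.exists_lTensor_subtype_eq_of_tmul_eq_zero hq hI h₂
  obtain ⟨t₃, ht₃⟩ := TensorProduct.exists_lTensor_subtype_eq_of_tmul_eq_zero hq hI h₃
  obtain ⟨t₄, ht₄⟩ := TensorProduct.exists_lTensor_subtype_eq_of_tmul_eq_zero hq hI h₄
  let f : I := ⟨z ^ 2 - x * y, hf⟩
  -- The coefficients are the negated first column of `syzygies`. In L the four terms add up to -(z²
  -- - xy) e₁, and injectivity carries the cancellation back to L ⊗ I.
  have hτ : e₁ ⊗ₜ[Q] f + z • t₁ + y • t₂ - (x + z) • t₃ + x • t₄ = 0 := by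
    refine hinj ((TensorProduct.rid Q L).injective ?_)
    simp only [map_add, map_sub, map_smul, ht₁, ht₂, ht₃, ht₄, map_zero, LinearMap.lTensor_tmul,
      TensorProduct.rid_tmul, Submodule.subtype_apply, f]
    module
  refine TensorProduct.mem_ker_mul_of_one_tmul_eq_zero hκ (f := f) ?_
  -- In κ ⊗ I the elements x, y, z act as zero, so only φ(e₁) ⊗ f = 1 ⊗ f survives.
  have := congrArg (φ.rTensor I) hτ
  have hxz : algebraMap Q κ (x + z) = 0 := by rw [map_add, hx, hz, add_zero]
  rwa [map_add, map_sub, map_add, map_add, map_smul, map_smul, map_smul, map_smul,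
    TensorProduct.smul_eq_zero_of_mem_ker hx, TensorProduct.smul_eq_zero_of_mem_ker hy,
    TensorProduct.smul_eq_zero_of_mem_ker hz, TensorProduct.smul_eq_zero_of_mem_ker hxz,
    add_zero, add_zero, sub_zero, add_zero, map_zero, LinearMap.rTensor_tmul, hφ] at this

end Obstruction

/-! ### A height argument in regular local rings. -/

open IsLocalRing

theorem Ideal.sup_pow_le {A : Type*} [CommSemiring A] (J K : Ideal A) (n : ℕ) :
    (J ⊔ K) ^ n ≤ J ⊔ K ^ n := by
  induction n with
  | zero => simp
  | succ n ih =>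
    rw [pow_succ, pow_succ]
    refine (Ideal.mul_mono_left ih).trans ?_
    rw [Ideal.sup_mul, Ideal.mul_sup (K ^ n)]
    exact sup_le (Ideal.mul_le_left.trans le_sup_left)
      (sup_le_sup_right Ideal.mul_le_right _)

/-- If `z² - xy` is a non-minimal generator of a proper ideal `I` of a regular local ring whose
maximal ideal is generated by `I`, `x`, `y` and `z`, then `z` is redundant up to `𝔪²`. -/
theorem IsRegularLocalRing.mem_of_sq_sub_mul_mem {Q : Type*} [CommRing Q] [IsRegularLocalRing Q]
    {I : Ideal Q} (hI : I ≤ maximalIdeal Q) {x y z : Q} (hx : x ∈ maximalIdeal Q)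
    (hy : y ∈ maximalIdeal Q) (hz : z ∈ maximalIdeal Q)
    (hm : maximalIdeal Q ≤ I ⊔ Ideal.span {x, y} ⊔ Ideal.span {z})
    (hf : z ^ 2 - x * y ∈ maximalIdeal Q * I) :
    z ∈ I ⊔ Ideal.span {x, y} ⊔ maximalIdeal Q ^ 2 := by
  by_contra hzN
  set m := maximalIdeal Q with hmdef
  set N : Ideal Q := I ⊔ Ideal.span {x, y} with hN
  have hNm : N ≤ m := sup_le hI (Ideal.span_le.mpr (by rintro _ (rfl | rfl) <;> assumption))
  have hres : Function.Surjective (algebraMap Q (ResidueField Q)) := residue_surjective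
  have hspan (s : Set m) :
      (Submodule.span (ResidueField Q) (m.toCotangent '' s) : Set (CotangentSpace Q)) =
        (Submodule.span Q s).map m.toCotangent := by
    rw [Submodule.map_span, ← Submodule.restrictScalars_span Q (ResidueField Q) hres]
    rfl
  let T : Submodule Q m := Submodule.comap m.subtype N
  -- b is a basis of the image of N = I + (x, y) in 𝔪/𝔪². This image misses the class of z, so b has
  -- fewer than dim Q elements; lifts of b will generate J.
  obtain ⟨b, hbT, hbspan, hbind⟩ := exists_linearIndependent (ResidueField Q)
    (m.toCotangent '' (T : Set m))
  have hzU : m.toCotangent ⟨z, hz⟩ ∉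
      Submodule.span (ResidueField Q) (m.toCotangent '' (T : Set m)) := by
    rw [← SetLike.mem_coe, hspan, Submodule.span_eq]
    rintro ⟨a, ha, haz⟩
    refine hzN ?_
    rw [Ideal.toCotangent_eq] at haz
    have : z = a + -((a : Q) - z) := by ring
    rw [this]
    exact add_mem (Ideal.mem_sup_left ha) (neg_mem (Ideal.mem_sup_right haz))
  have hbfin : b.Finite := hbind.setFinite
  have hlt : b.ncard < Module.finrank (ResidueField Q) (CotangentSpace Q) := by
    have := hbfin.fintype
    rw [Set.ncard_eq_toFinset_card', ← finrank_span_set_eq_card hbind, hbspan]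
    exact Submodule.finrank_lt fun h ↦ hzU (h ▸ Submodule.mem_top)
  choose! g hgT hg using fun v (hv : v ∈ b) ↦ hbT hv
  let s : Set Q := (fun v ↦ (g v : Q)) '' b
  let J : Ideal Q := Ideal.span s
  have hJN : J ≤ N := Ideal.span_le.mpr (by rintro _ ⟨v, hv, rfl⟩; exact hgT v hv)
  have hNJ : N ≤ J ⊔ m ^ 2 := by
    intro a ha
    have ham : m.toCotangent ⟨a, hNm ha⟩ ∈ Submodule.span (ResidueField Q) b := by
      rw [hbspan]
      exact Submodule.subset_span ⟨_, ha, rfl⟩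
    have hbg : b = m.toCotangent '' (g '' b) := by
      rw [Set.image_image, Set.image_congr hg, Set.image_id']
    rw [hbg, ← SetLike.mem_coe, hspan] at ham
    obtain ⟨j, hj, hja⟩ := ham
    have hjJ : (j : Q) ∈ J := by
      have := Submodule.mem_map_of_mem (f := m.subtype) hj
      rwa [Submodule.map_span, Set.image_image] at this
    rw [Ideal.toCotangent_eq] at hja
    have : a = j + -((j : Q) - a) := by ring
    rw [this]
    exact add_mem (Ideal.mem_sup_left hjJ) (neg_mem (Ideal.mem_sup_right hja))
  have hmJ : m ≤ J ⊔ Ideal.span {z} := by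
    refine Submodule.le_of_le_smul_of_le_jacobson_bot (I := m) (IsNoetherian.noetherian _)
      (maximalIdeal_le_jacobson _) (hm.trans (sup_le (hNJ.trans (sup_le ?_ ?_)) ?_))
    · exact le_sup_left.trans le_sup_left
    · rw [smul_eq_mul, ← sq]
      exact le_sup_right
    · exact le_sup_right.trans le_sup_left
  have hpow (n : ℕ) : m ^ n ≤ J ⊔ Ideal.span {z ^ n} := by
    rw [← Ideal.span_singleton_pow]
    exact (Ideal.pow_right_mono hmJ n).trans (Ideal.sup_pow_le _ _ n)
  have hmN : m * N ≤ J ⊔ m ^ 3 := by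
    refine (Ideal.mul_mono_right hNJ).trans ?_
    rw [Ideal.mul_sup]
    exact sup_le_sup Ideal.mul_le_right (by rw [pow_succ' m 2])
  -- z² = f + xy lies in 𝔪N ⊆ J + 𝔪³ ⊆ J + (z³), and 1 - cz is a unit.
  have hz2 : z ^ 2 ∈ J := by
    have h1 : z ^ 2 ∈ J ⊔ Ideal.span {z ^ 3} := by
      refine sup_le le_sup_left (hpow 3) (hmN ?_)
      rw [← sub_add_cancel (z ^ 2) (x * y)]
      exact add_mem (Ideal.mul_mono_right le_sup_left hf) (Ideal.mul_mem_mul hx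
        (Ideal.mem_sup_right (Ideal.subset_span (by simp))))
    obtain ⟨j, hj, c, hc, hjc⟩ := Submodule.mem_sup.mp h1
    obtain ⟨c, rfl⟩ := Ideal.mem_span_singleton'.mp hc
    have hu : IsUnit (1 - c * z) := by
      by_contra hu
      exact (Ideal.ne_top_iff_one m).mp Ideal.IsPrime.ne_top'
        ((sub_add_cancel (1 : Q) (c * z)) ▸ add_mem hu (m.mul_mem_left c hz))
    rw [← Ideal.mul_unit_mem_iff_mem J hu]
    convert! hj using 1
    linear_combination -hjc
  have hrad : m ≤ J.radical := by
    intro a ha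
    exact ⟨2, sup_le le_rfl ((Ideal.span_singleton_le_iff_mem J).mpr hz2)
      (hpow 2 (Ideal.pow_mem_pow ha 2))⟩
  -- Now 𝔪² ⊆ J, so Krull's height theorem bounds dim Q by the number of generators of J, a
  -- contradiction.
  have hmin : m ∈ J.minimalPrimes :=
    ⟨⟨inferInstance, hJN.trans hNm⟩, fun p hp _ ↦ hrad.trans (hp.1.radical_le_iff.mpr hp.2)⟩
  have hht := Ideal.height_le_card_of_mem_minimalPrimes_span (hbfin.image _) hmin
  have hdim := (IsRegularLocalRing.iff_finrank_cotangentSpace Q).mp inferInstance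
  rw [← maximalIdeal_height_eq_ringKrullDim] at hdim
  have hcard := Set.ncard_image_le (f := fun v ↦ (g v : Q)) hbfin
  have : (Module.finrank (ResidueField Q) (CotangentSpace Q) : ℕ∞) = m.height := by
    exact_mod_cast hdim
  rw [← this] at hht
  exact absurd (Nat.cast_le.mp hht) (by omega)

/-! ### Base change of cokernels. -/

namespace Matrix

variable {A B : Type*} [CommRing A] [CommRing B] [Algebra A B] {m n : Type*} [Fintype m]
  [DecidableEq m] [Fintype n]

/-- The cokernel of a matrix commutes with base change along a surjective ring homomorphism. -/
theorem nonempty_baseChange_coker_equiv (h : Function.Surjective (algebraMap A B))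
    (D : Matrix m n A) :
    Nonempty ((B ⊗[A] ((m → A) ⧸ LinearMap.range D.mulVecLin)) ≃ₗ[B]
      ((m → B) ⧸ LinearMap.range (D.map (algebraMap A B)).mulVecLin)) := by
  let D' := D.map (algebraMap A B)
  let N := LinearMap.range D'.mulVecLin
  let c : (m → A) →ₗ[A] (m → B) := (Algebra.linearMap A B).compLeft m
  have hc (w : n → A) : c (D *ᵥ w) = D' *ᵥ (algebraMap A B ∘ w) :=
    (algebraMap A B).map_mulVec D w |> fun h ↦ by ext i; exact h i
  let g : ((m → A) ⧸ LinearMap.range D.mulVecLin) →ₗ[A] ((m → B) ⧸ N) :=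
    Submodule.liftQ _ (N.mkQ.restrictScalars A ∘ₗ c) <| by
      rintro _ ⟨w, rfl⟩
      simp only [LinearMap.mem_ker, LinearMap.comp_apply, mulVecLin_apply, hc]
      exact (Submodule.Quotient.mk_eq_zero N).mpr ⟨_, rfl⟩
  have hg (v : m → A) : g (Submodule.Quotient.mk v) = N.mkQ (c v) := rfl
  refine ⟨LinearEquiv.ofBijective (g.liftBaseChange B) ⟨?_, ?_⟩⟩
  · rw [injective_iff_map_eq_zero]
    intro t ht
    obtain ⟨l, rfl⟩ := TensorProduct.mk_surjective A _ B h t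
    obtain ⟨v, rfl⟩ := Submodule.Quotient.mk_surjective _ l
    rw [TensorProduct.mk_apply, LinearMap.liftBaseChange_tmul, one_smul, hg, Submodule.mkQ_apply,
      Submodule.Quotient.mk_eq_zero] at ht
    obtain ⟨w', hw'⟩ := ht
    obtain ⟨w, rfl⟩ := h.comp_left w'
    have hu (i : m) : algebraMap A B ((v - D *ᵥ w) i) = 0 := by
      have := congrFun (hc w) i
      rw [mulVecLin_apply] at hw'
      rw [hw'] at this
      simpa [sub_eq_zero, c] using this.symm
    have hv : (Submodule.Quotient.mk v : (m → A) ⧸ LinearMap.range D.mulVecLin) =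
        Submodule.Quotient.mk (v - D *ᵥ w) := by
      rw [eq_comm, Submodule.Quotient.eq]
      exact ⟨-w, by simp [mulVec_neg]⟩
    rw [hv, pi_eq_sum_univ' (v - D *ᵥ w), ← Submodule.mkQ_apply, map_sum, map_sum]
    refine Finset.sum_eq_zero fun i _ ↦ ?_
    rw [map_smul, TensorProduct.mk_apply, TensorProduct.tmul_smul, TensorProduct.smul_tmul',
      Algebra.smul_def, hu, zero_mul, TensorProduct.zero_tmul]
  · intro q
    obtain ⟨v', rfl⟩ := Submodule.Quotient.mk_surjective _ q
    obtain ⟨v, rfl⟩ := h.comp_left v'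
    exact ⟨1 ⊗ₜ Submodule.Quotient.mk v, by
      rw [LinearMap.liftBaseChange_tmul, one_smul, hg]; rfl⟩

end Matrix

/-! ### The presentation matrix and its syzygies. -/

namespace SerreLifting

open scoped Matrix

section Presentation

variable {A : Type*} [CommRing A] (x y z : A)

/-- The presentation matrix of `M` over an arbitrary ring with three chosen elements. -/
def presentation : Matrix (Fin 2) (Fin 4) A :=
  !![x, 0, z, y;
     y, x, y, 0]

/-- The relations between the columns of the presentation matrix, valid when `z² = xy`. -/
def syzygies : Matrix (Fin 4) (Fin 2) A :=
  !![-z, y;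
     -y, 0;
     x + z, -y;
     -x, z - x]

theorem presentation_mulVec (v : Fin 4 → A) :
    presentation x y z *ᵥ v =
      ![x * v 0 + z * v 2 + y * v 3, y * v 0 + x * v 1 + y * v 2] := by
  ext i
  fin_cases i <;> simp [presentation, Matrix.mulVec, dotProduct, Fin.sum_univ_four]

theorem syzygies_mulVec (w : Fin 2 → A) :
    syzygies x y z *ᵥ w =
      ![-z * w 0 + y * w 1, -y * w 0, (x + z) * w 0 - y * w 1, -x * w 0 + (z - x) * w 1] := by
  ext i
  fin_cases i <;> simp [syzygies, Matrix.mulVec, dotProduct]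
  all_goals ring

/-- The cokernel of the presentation matrix. -/
abbrev Coker : Type _ := (Fin 2 → A) ⧸ LinearMap.range (presentation x y z).mulVecLin

theorem mem_annihilator_coker {a : A}
    (h : ∀ v : Fin 2 → A, ∃ w, presentation x y z *ᵥ w = a • v) :
    a ∈ Module.annihilator A (Coker x y z) := by
  rw [Module.mem_annihilator]
  intro q
  obtain ⟨v, rfl⟩ := Submodule.Quotient.mk_surjective _ q
  rw [← Submodule.Quotient.mk_smul, Submodule.Quotient.mk_eq_zero]
  exact h v

/-- No relation between x, y, z enters here, so the same computation serves M and its Serre lift. -/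
theorem sq_left_mem_annihilator_coker : x ^ 2 ∈ Module.annihilator A (Coker x y z) := by
  refine mem_annihilator_coker x y z fun v ↦
    ⟨![x * v 0, -(y * v 0) + x * v 1, 0, 0], ?_⟩
  rw [presentation_mulVec]
  ext i
  fin_cases i <;> simp <;> ring

theorem sq_right_mem_annihilator_coker : y ^ 2 ∈ Module.annihilator A (Coker x y z) := by
  refine mem_annihilator_coker x y z fun v ↦
    ⟨![y * v 1, 0, 0, y * v 0 - x * v 1], ?_⟩
  rw [presentation_mulVec]
  ext i
  fin_cases i <;> simp <;> ring

theorem mul_mem_annihilator_coker : x * y ∈ Module.annihilator A (Coker x y z) := by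
  refine mem_annihilator_coker x y z fun v ↦ ⟨![0, y * v 1, 0, x * v 0], ?_⟩
  rw [presentation_mulVec]
  ext i
  fin_cases i <;> simp <;> ring

variable {x y z}

theorem presentation_mulVec_syzygies_mulVec (h : z ^ 2 = x * y) (w : Fin 2 → A) :
    presentation x y z *ᵥ (syzygies x y z *ᵥ w) = 0 := by
  rw [presentation_mulVec, syzygies_mulVec]
  ext i
  fin_cases i <;> simp
  · linear_combination w 0 * h
  · ring

theorem syzygies_mulVec_injective (hy : ∀ a, y * a = 0 → a = 0) :
    Function.Injective (syzygies x y z).mulVecLin := by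
  rw [injective_iff_map_eq_zero]
  intro w hw
  rw [Matrix.mulVecLin_apply, syzygies_mulVec] at hw
  have h0 : w 0 = 0 := hy _ (by simpa using congrFun hw 1)
  have h1 : w 1 = 0 := hy _ (by simpa [h0] using congrFun hw 0)
  ext i
  fin_cases i
  exacts [h0, h1]

/-- Modulo y one has x² = (x + z)(x - z), so x - z is a nonzerodivisor along with x. The second row
then gives v₁ = yb, and the first row gives v₀ - zb = yc; cancelling y determines v₂ and v₃ from b
and c. -/
theorem exact_syzygies_presentation (h : z ^ 2 = x * y) (hy : ∀ a, y * a = 0 → a = 0)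
    (hx : ∀ a, y ∣ x * a → y ∣ a) :
    Function.Exact (syzygies x y z).mulVecLin (presentation x y z).mulVecLin := by
  intro v
  simp only [Matrix.mulVecLin_apply]
  refine ⟨fun hv ↦ ?_, ?_⟩
  · rw [presentation_mulVec] at hv
    have h0 : x * v 0 + z * v 2 + y * v 3 = 0 := by simpa using congrFun hv 0
    have h1 : y * v 0 + x * v 1 + y * v 2 = 0 := by simpa using congrFun hv 1
    have hxz (a : A) (ha : y ∣ (x - z) * a) : y ∣ a := by
      refine hx a (hx _ ?_)
      have : x * (x * a) = (x + z) * ((x - z) * a) + y * (x * a) := by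
        linear_combination a * h
      rw [this]
      exact dvd_add (ha.mul_left _) (dvd_mul_right _ _)
    obtain ⟨b, hb⟩ := hx (v 1) ⟨-(v 0 + v 2), by linear_combination h1⟩
    have hac : v 0 + v 2 + x * b = 0 := hy _ (by linear_combination h1 - x * hb)
    obtain ⟨c, hc⟩ := hxz (v 0 - z * b) ⟨x * b - v 3, by
      linear_combination h0 - z * hac + b * h⟩
    have hd : v 3 - x * b + (x - z) * c = 0 := hy _ (by
      linear_combination h0 - z * hac + b * h - (x - z) * hc)
    refine ⟨![-b, c], ?_⟩
    rw [Matrix.mulVecLin_apply, syzygies_mulVec]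
    ext i
    fin_cases i <;> simp
    · linear_combination -hc
    · linear_combination -hb
    · linear_combination hc - hac
    · linear_combination -hd
  · rintro ⟨w, rfl⟩
    exact presentation_mulVec_syzygies_mulVec h w

end Presentation

end SerreLifting

/-! ### Projective dimension from a length-two resolution. -/

section ProjectiveDimension

open CategoryTheory

/-- If the projective dimension were at most 1, the image of `d₁` would be projective, and d₂ would
split. -/
theorem projectiveDimension_coker_eq_two {A : Type u} [CommRing A] {F₀ F₁ F₂ : Type u}
    [AddCommGroup F₀] [Module A F₀] [AddCommGroup F₁] [Module A F₁] [AddCommGroup F₂] [Module A F₂]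
    [Module.Projective A F₀] [Module.Projective A F₁] [Module.Projective A F₂]
    {d₂ : F₂ →ₗ[A] F₁} {d₁ : F₁ →ₗ[A] F₀} (hexact : Function.Exact d₂ d₁)
    (hinj : Function.Injective d₂) (hsplit : ¬ ∃ r : F₁ →ₗ[A] F₂, r ∘ₗ d₂ = LinearMap.id) :
    projectiveDimension (ModuleCat.of A (F₀ ⧸ LinearMap.range d₁)) = 2 := by
  let K := LinearMap.range d₁
  have hexact' : Function.Exact d₂ d₁.rangeRestrict := fun v ↦ by
    rw [← hexact v, ← Subtype.val_inj]
    rfl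
  have hS := ModuleCat.shortComplex_shortExact
    (ModuleCat.shortComplexOfCompEqZero d₂ d₁.rangeRestrict hexact'.linearMap_comp_eq_zero)
    hexact' hinj d₁.surjective_rangeRestrict
  have hT := ModuleCat.shortComplex_shortExact
    (ModuleCat.shortComplexOfCompEqZero K.subtype K.mkQ (LinearMap.exact_subtype_mkQ K
      |>.linearMap_comp_eq_zero))
    (LinearMap.exact_subtype_mkQ K) K.injective_subtype K.mkQ_surjective
  have hp₀ : Projective (ModuleCat.of A F₀) := (IsProjective.iff_projective F₀).mp inferInstance
  have hp₁ : Projective (ModuleCat.of A F₁) := (IsProjective.iff_projective F₁).mp inferInstance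
  have hp₂ : Projective (ModuleCat.of A F₂) := (IsProjective.iff_projective F₂).mp inferInstance
  refine le_antisymm ?_ ?_
  · refine (projectiveDimension_le_iff _ 2).mpr ?_
    refine (hT.hasProjectiveDimensionLT_X₃_iff 1 hp₀).mpr ?_
    refine (hS.hasProjectiveDimensionLT_X₃_iff 0 hp₁).mpr ?_
    exact (projective_iff_hasProjectiveDimensionLT_one).mp hp₂
  · refine (projectiveDimension_ge_iff _ 2).mpr fun h ↦ hsplit ?_
    have hK := (projective_iff_hasProjectiveDimensionLT_one).mpr
      ((hT.hasProjectiveDimensionLT_X₃_iff 0 hp₀).mp h)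
    have : Module.Projective A K := (IsProjective.iff_projective K).mpr hK
    obtain ⟨s, hs⟩ := Module.projective_lifting_property d₁.rangeRestrict LinearMap.id
      d₁.surjective_rangeRestrict
    have htfae := hexact'.split_tfae'.out 0 1
    exact (htfae.mp ⟨hinj, s, hs⟩).2

end ProjectiveDimension

theorem Matrix.not_exists_leftInverse_of_entries_mem {A : Type*} [CommRing A] {m n : Type*}
    [Fintype m] [Fintype n] [DecidableEq m] [DecidableEq n] [Nonempty n] {I : Ideal A} (hI : I ≠ ⊤)
    {D : Matrix m n A} (hD : ∀ i j, D i j ∈ I) :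
    ¬ ∃ r : (m → A) →ₗ[A] (n → A), r ∘ₗ D.mulVecLin = LinearMap.id := by
  rintro ⟨r, hr⟩
  obtain ⟨j⟩ := ‹Nonempty n›
  have h := congrFun (LinearMap.congr_fun hr (Pi.single j 1)) j
  rw [LinearMap.comp_apply, mulVecLin_apply, mulVec_single_one, pi_eq_sum_univ' (D.col j), map_sum,
    Finset.sum_apply] at h
  refine hI ((Ideal.eq_top_iff_one I).mpr ?_)
  have h1 : (1 : A) = ∑ i, r (D.col j i • Pi.single i 1) j := by
    rw [h, LinearMap.id_apply, Pi.single_eq_same]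
  rw [h1]
  refine Ideal.sum_mem _ fun i _ ↦ ?_
  rw [map_smul]
  exact I.mul_mem_right _ (hD i j)

/-! ### The ring R and the module M. -/

namespace SerreLifting

variable (k : Type u) [Field k]

open MvPowerSeries

theorem var_two_sq : var k 2 ^ 2 = var k 0 * var k 1 := by
  rw [← sub_eq_zero]
  exact Ideal.Quotient.eq_zero_iff_mem.mpr (Ideal.mem_span_singleton_self _)

theorem exists_eq_X_mul_add_X_mul {φ : S k} {s t : Fin 3}
    (h : φ ∈ Ideal.span ((X : Fin 3 → S k) '' ({s, t} : Finset (Fin 3)))) :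
    ∃ a b, φ = X s * a + X t * b := by
  rw [Finset.coe_insert, Finset.coe_singleton, Set.image_pair, Ideal.mem_span_pair] at h
  obtain ⟨a, b, h⟩ := h
  exact ⟨a, b, by rw [← h]; ring⟩

theorem exists_eq_X_mul {φ : S k} {s : Fin 3}
    (h : φ ∈ Ideal.span ((X : Fin 3 → S k) '' ({s} : Finset (Fin 3)))) : ∃ a, φ = X s * a := by
  rwa [Finset.coe_singleton, Set.image_singleton, Ideal.mem_span_singleton] at h

theorem X_mul_mem_span (s : Fin 3) (a : S k) (T : Finset (Fin 3)) (hs : s ∈ T) :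
    X s * a ∈ Ideal.span ((X : Fin 3 → S k) '' T) :=
  Ideal.mul_mem_right _ _ (Ideal.subset_span ⟨s, hs, rfl⟩)

/-- If ya = fb in S, then z²b ∈ (y), so y divides b and can be cancelled. -/
theorem eq_zero_of_var_one_mul_eq_zero (a : R k) (h : var k 1 * a = 0) : a = 0 := by
  obtain ⟨a, rfl⟩ := Ideal.Quotient.mk_surjective a
  obtain ⟨b, hb⟩ := Ideal.mem_span_singleton.mp (Ideal.Quotient.eq_zero_iff_mem.mp
    (show Ideal.Quotient.mk _ (X 1 * a) = 0 by rw [map_mul]; exact h))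
  have h2 : X 2 * (X 2 * b) ∈ Ideal.span ((X : Fin 3 → S k) '' ({1} : Finset (Fin 3))) := by
    have : X 2 * (X 2 * b) = X 1 * (a + X 0 * b) := by linear_combination -hb
    rw [this]
    exact X_mul_mem_span k _ _ _ (by simp)
  obtain ⟨c, rfl⟩ := exists_eq_X_mul k (mem_span_X_image_of_X_mul_mem (by decide)
    (mem_span_X_image_of_X_mul_mem (by decide) h2))
  refine Ideal.Quotient.eq_zero_iff_mem.mpr (Ideal.mem_span_singleton.mpr ⟨c, ?_⟩)
  refine mul_left_cancel₀ (show (X 1 : S k) ≠ 0 from fun h ↦ by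
    simpa using congrArg (coeff (Finsupp.single 1 1)) h) ?_
  linear_combination hb

/-- If xa - yb = fc in S, then z²c ∈ (x, y). Writing c = xc₀ + yc₁ and collecting the multiples of x
shows that y divides a + yc - z²c₀, and z²c₀ ≡ xyc₀ modulo f. -/
theorem var_one_dvd_of_dvd_var_zero_mul (a : R k) (h : var k 1 ∣ var k 0 * a) : var k 1 ∣ a := by
  obtain ⟨a, rfl⟩ := Ideal.Quotient.mk_surjective a
  obtain ⟨b, hb⟩ := h
  obtain ⟨b, rfl⟩ := Ideal.Quotient.mk_surjective b
  obtain ⟨c, hc⟩ := Ideal.mem_span_singleton.mp ((Ideal.Quotient.mk_eq_mk_iff_sub_mem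
    (X 0 * a) (X 1 * b)).mp (by rw [map_mul, map_mul]; exact hb))
  have h2 : X 2 * (X 2 * c) ∈ Ideal.span ((X : Fin 3 → S k) '' ({0, 1} : Finset (Fin 3))) := by
    have : X 2 * (X 2 * c) = X 0 * (a + X 1 * c) + X 1 * -b := by linear_combination -hc
    rw [this]
    exact add_mem (X_mul_mem_span k _ _ _ (by simp)) (X_mul_mem_span k _ _ _ (by simp))
  obtain ⟨c₀, c₁, rfl⟩ := exists_eq_X_mul_add_X_mul k (mem_span_X_image_of_X_mul_mem (by decide)
    (mem_span_X_image_of_X_mul_mem (by decide) h2))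
  have h0 : X 0 * (a + X 1 * (X 0 * c₀ + X 1 * c₁) - X 2 ^ 2 * c₀) ∈
      Ideal.span ((X : Fin 3 → S k) '' ({1} : Finset (Fin 3))) := by
    have : X 0 * (a + X 1 * (X 0 * c₀ + X 1 * c₁) - X 2 ^ 2 * c₀) =
        X 1 * (b + X 2 ^ 2 * c₁) := by linear_combination hc
    rw [this]
    exact X_mul_mem_span k _ _ _ (by simp)
  obtain ⟨e, he⟩ := exists_eq_X_mul k (mem_span_X_image_of_X_mul_mem (by decide) h0)
  refine ⟨Ideal.Quotient.mk _ (e - X 1 * c₁), ?_⟩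
  change _ = Ideal.Quotient.mk _ (X 1) * _
  rw [← map_mul, Ideal.Quotient.mk_eq_mk_iff_sub_mem, Ideal.mem_span_singleton]
  exact ⟨c₀, by linear_combination he⟩

theorem d₁_eq_presentation : d₁ k = presentation (var k 0) (var k 1) (var k 2) := rfl

theorem X_mem_maximalIdeal (i : Fin 3) : (X i : S k) ∈ maximalIdeal (S k) := by
  rw [maximalIdeal_eq_span_range_X]
  exact Ideal.subset_span ⟨i, rfl⟩

theorem sq_sub_mul_mem_sq_maximalIdeal :
    (X 2 ^ 2 - X 0 * X 1 : S k) ∈ maximalIdeal (S k) ^ 2 :=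
  sub_mem (Ideal.pow_mem_pow (X_mem_maximalIdeal k 2) 2) <| by
    rw [sq]
    exact Ideal.mul_mem_mul (X_mem_maximalIdeal k 0) (X_mem_maximalIdeal k 1)

theorem sq_sub_mul_ne_zero : (X 2 ^ 2 - X 0 * X 1 : S k) ≠ 0 := by
  intro h
  have hmem : X 2 * (X 2 * 1) ∈ Ideal.span ((X : Fin 3 → S k) '' ({0} : Finset (Fin 3))) := by
    have : (X 2 * (X 2 * 1) : S k) = X 0 * X 1 := by linear_combination h
    rw [this]
    exact X_mul_mem_span k _ _ _ (by simp)
  have h1 := mem_span_X_image_of_X_mul_mem (by decide)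
    (mem_span_X_image_of_X_mul_mem (by decide) hmem)
  rw [mem_span_X_image_iff] at h1
  simpa using h1 0 (by simp)

instance : Nontrivial (R k) :=
  Ideal.Quotient.nontrivial_iff.mpr fun h ↦ Ideal.IsPrime.ne_top' (I := maximalIdeal (S k)) <| by
    rw [eq_top_iff, ← h, Ideal.span_singleton_le_iff_mem]
    exact Ideal.pow_le_self two_ne_zero (sq_sub_mul_mem_sq_maximalIdeal k)

instance : IsLocalRing (R k) :=
  .of_surjective' (Ideal.Quotient.mk _) Ideal.Quotient.mk_surjective

theorem maximalIdeal_R : maximalIdeal (R k) = Ideal.span (Set.range (var k)) := by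
  rw [← map_maximalIdeal_of_surjective (algebraMap (S k) (R k)) Ideal.Quotient.mk_surjective,
    maximalIdeal_eq_span_range_X, Ideal.map_span, ← Set.range_comp]
  rfl

theorem var_mem_maximalIdeal (i : Fin 3) : var k i ∈ maximalIdeal (R k) := by
  rw [maximalIdeal_R]
  exact Ideal.subset_span ⟨i, rfl⟩

theorem projectiveDimension_M :
    CategoryTheory.projectiveDimension (ModuleCat.of (R k) (M k)) = 2 := by
  refine projectiveDimension_coker_eq_two (d₁ := (d₁ k).mulVecLin)
    (exact_syzygies_presentation (var_two_sq k) (eq_zero_of_var_one_mul_eq_zero k)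
      (var_one_dvd_of_dvd_var_zero_mul k))
    (syzygies_mulVec_injective (eq_zero_of_var_one_mul_eq_zero k))
    (Matrix.not_exists_leftInverse_of_entries_mem (I := maximalIdeal (R k))
      Ideal.IsPrime.ne_top' ?_)
  have h := var_mem_maximalIdeal k
  intro i j
  fin_cases i <;> fin_cases j <;>
    simp [syzygies, h, add_mem, sub_mem, -mem_maximalIdeal]

theorem maximalIdeal_le_radical_annihilator_M :
    maximalIdeal (R k) ≤ (Module.annihilator (R k) (M k)).radical := by
  rw [maximalIdeal_R, Ideal.span_le]
  rintro _ ⟨i, rfl⟩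
  refine ⟨2, ?_⟩
  fin_cases i
  · exact sq_left_mem_annihilator_coker (var k 0) (var k 1) (var k 2)
  · exact sq_right_mem_annihilator_coker (var k 0) (var k 1) (var k 2)
  · exact (var_two_sq k).symm ▸ mul_mem_annihilator_coker (var k 0) (var k 1) (var k 2)

theorem isFiniteLength_M : IsFiniteLength (R k) (M k) :=
  Module.isFiniteLength_of_maximalIdeal_le_radical_annihilator
    (maximalIdeal_le_radical_annihilator_M k)

/-- The functional on `M` reading off the first coordinate modulo the maximal ideal. -/
noncomputable def coordM : M k →ₗ[R k] ResidueField (R k) :=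
  Submodule.liftQ _ (Algebra.linearMap (R k) (ResidueField (R k)) ∘ₗ LinearMap.proj 0) <| by
    rintro _ ⟨w, rfl⟩
    have h (i : Fin 3) : algebraMap (R k) (ResidueField (R k)) (var k i) = 0 :=
      (residue_eq_zero_iff _).mpr (var_mem_maximalIdeal k i)
    rw [LinearMap.mem_ker, LinearMap.comp_apply, Matrix.mulVecLin_apply, d₁_eq_presentation,
      presentation_mulVec]
    simp only [LinearMap.proj_apply, Matrix.cons_val_zero, Algebra.linearMap_apply, map_add,
      map_mul, h, zero_mul, add_zero]

theorem coordM_mk (v : Fin 2 → R k) :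
    coordM k (Submodule.Quotient.mk v) = residue (R k) (v 0) := rfl

instance : Nontrivial (M k) :=
  nontrivial_of_ne (Submodule.Quotient.mk (fun _ ↦ 1)) 0 fun h ↦
    one_ne_zero (α := ResidueField (R k)) <| by
      simpa [coordM_mk] using congrArg (coordM k) h

theorem supportDim_M : Module.supportDim (R k) (M k) = 0 := by
  refine le_antisymm ?_ ?_
  · refine (Module.supportDim_le_ringKrullDim_quotient
      (maximalIdeal_le_radical_annihilator_M k)).trans_eq ?_
    exact ringKrullDim_eq_zero_of_field (ResidueField (R k))
  · rw [Module.supportDim_eq_ringKrullDim_quotient_annihilator]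
    have : Nontrivial (R k ⧸ Module.annihilator (R k) (M k)) := by
      rw [Ideal.Quotient.nontrivial_iff, Ne, Module.annihilator_eq_top_iff]
      exact not_subsingleton _
    exact ringKrullDim_nonneg_of_nontrivial

end SerreLifting

/-! ### The Serre lift over S. -/

namespace SerreLifting

variable (k : Type u) [Field k]

open MvPowerSeries

theorem ringKrullDim_R_add_one : ringKrullDim (R k) + 1 = 3 := by
  rw [ringKrullDim_quotient_span_singleton_succ_eq_ringKrullDim_of_mem_nonZeroDivisors
    (mem_nonZeroDivisors_of_ne_zero (sq_sub_mul_ne_zero k))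
    (Ideal.pow_le_self two_ne_zero (sq_sub_mul_mem_sq_maximalIdeal k)), ringKrullDim_fin]
  rfl

/-- The ideal `(x, y)` of the power series ring. -/
noncomputable abbrev axisIdeal : Ideal (S k) := Ideal.span {X 0, X 1}

theorem axisIdeal_le_maximalIdeal : axisIdeal k ≤ maximalIdeal (S k) :=
  Ideal.span_le.mpr (by
    rintro _ (rfl | rfl)
    exacts [X_mem_maximalIdeal k 0, X_mem_maximalIdeal k 1])

theorem ringKrullDim_quotient_axisIdeal : ringKrullDim (S k ⧸ axisIdeal k) = 1 := by
  have hne : axisIdeal k ≠ ⊤ := ne_top_of_le_ne_top Ideal.IsPrime.ne_top'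
    (axisIdeal_le_maximalIdeal k)
  have : Nontrivial (S k ⧸ axisIdeal k) := Ideal.Quotient.nontrivial_iff.mpr hne
  have : IsLocalRing (S k ⧸ axisIdeal k) :=
    .of_surjective' (Ideal.Quotient.mk _) Ideal.Quotient.mk_surjective
  refine le_antisymm ?_ ?_
  · have hmax : maximalIdeal (S k ⧸ axisIdeal k) =
        Ideal.span {Ideal.Quotient.mk (axisIdeal k) (X 2)} := by
      rw [← map_maximalIdeal_of_surjective (Ideal.Quotient.mk (axisIdeal k))
        Ideal.Quotient.mk_surjective, maximalIdeal_eq_span_range_X, Ideal.map_span]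
      refine le_antisymm (Ideal.span_le.mpr ?_) (Ideal.span_mono (by
        rintro _ rfl
        exact ⟨_, ⟨2, rfl⟩, rfl⟩))
      rintro _ ⟨_, ⟨i, rfl⟩, rfl⟩
      have h (i : Fin 3) (hi : (X i : S k) ∈ ({X 0, X 1} : Set (S k))) :
          Ideal.Quotient.mk (axisIdeal k) (X i) = 0 :=
        Ideal.Quotient.eq_zero_iff_mem.mpr (Ideal.subset_span hi)
      fin_cases i
      · exact (h 0 (by simp)) ▸ zero_mem _
      · exact (h 1 (by simp)) ▸ zero_mem _
      · exact Ideal.subset_span rfl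
    refine (ringKrullDim_le_spanFinrank_maximalIdeal _).trans ?_
    rw [hmax]
    exact_mod_cast (Submodule.spanFinrank_span_le_ncard_of_finite (Set.finite_singleton _)).trans
      (Set.ncard_singleton _).le
  -- Two generators lower the dimension 3 by at most 2; the rest is arithmetic in `WithBot ℕ∞`.
  · have h := ringKrullDim_le_ringKrullDim_quotient_add_spanFinrank (axisIdeal k) <| by
      rw [ringJacobson_eq_maximalIdeal]
      exact axisIdeal_le_maximalIdeal k
    have h2 : (axisIdeal k).spanFinrank ≤ 2 :=
      (Submodule.spanFinrank_span_le_ncard_of_finite (by simp)).trans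
        ((Set.ncard_insert_le _ _).trans (by simp))
    rw [ringKrullDim_fin] at h
    have h3 : ((3 : ℕ) : WithBot ℕ∞) ≤ ringKrullDim (S k ⧸ axisIdeal k) + (2 : ℕ) :=
      h.trans (by gcongr)
    generalize ringKrullDim (S k ⧸ axisIdeal k) = d at h3
    induction d with
    | bot => simp at h3
    | coe d =>
      induction d with
      | top => exact le_top
      | coe d =>
        have h4 : ((3 : ℕ) : ℕ∞) ≤ (d : ℕ∞) + (2 : ℕ) := WithBot.coe_le_coe.mp h3
        norm_cast at h4
        have h5 : 1 ≤ d := by omega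
        exact_mod_cast h5

/-- The Serre lift of `M`: the cokernel over the power series ring of the same matrix. -/
abbrev serreLift : Type u := Coker (X 0 : S k) (X 1) (X 2)

theorem supportDim_serreLift : Module.supportDim (S k) (serreLift k) = 1 := by
  rw [← ringKrullDim_quotient_axisIdeal k]
  refine le_antisymm (Module.supportDim_le_ringKrullDim_quotient (Ideal.span_le.mpr ?_)) ?_
  · rintro _ (rfl | rfl)
    · exact ⟨2, sq_left_mem_annihilator_coker _ _ _⟩
    · exact ⟨2, sq_right_mem_annihilator_coker _ _ _⟩
  · rw [← Module.supportDim_quotient_eq_ringKrullDim]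
    -- The second coordinate gives a surjection onto S/(x, y), because the second row has entries in
    -- (x, y); the first row contains z.
    refine Module.supportDim_le_of_surjective (Submodule.liftQ _
      ((axisIdeal k).mkQ ∘ₗ LinearMap.proj (R := S k) (φ := fun _ : Fin 2 ↦ S k) 1) ?_) ?_
    · rintro _ ⟨w, rfl⟩
      rw [LinearMap.mem_ker, LinearMap.comp_apply, Matrix.mulVecLin_apply, presentation_mulVec]
      refine (Submodule.Quotient.mk_eq_zero _).mpr ?_
      have h0 : (X 0 : S k) ∈ axisIdeal k := Ideal.subset_span (by simp)
      have h1 : (X 1 : S k) ∈ axisIdeal k := Ideal.subset_span (by simp)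
      exact add_mem (add_mem (Ideal.mul_mem_right _ _ h1) (Ideal.mul_mem_right _ _ h0))
        (Ideal.mul_mem_right _ _ h1)
    · intro q
      obtain ⟨a, rfl⟩ := Submodule.Quotient.mk_surjective _ q
      exact ⟨Submodule.Quotient.mk (fun _ ↦ a), rfl⟩

theorem isSerreLiftable_M : IsSerreLiftable (S k) (R k) (M k) := by
  refine ⟨inferInstance, Ideal.Quotient.mk_surjective, serreLift k, inferInstance, inferInstance,
    inferInstance, ?_, ?_⟩
  · have hmap : (presentation (X 0 : S k) (X 1) (X 2)).map (algebraMap (S k) (R k)) = d₁ k := by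
      ext i j
      fin_cases i <;> fin_cases j <;> simp [presentation, d₁, var]
    have h := Matrix.nonempty_baseChange_coker_equiv (B := R k) Ideal.Quotient.mk_surjective
      (presentation (X 0 : S k) (X 1) (X 2))
    rwa [hmap] at h
  · rw [supportDim_M, supportDim_serreLift, ringKrullDim_R_add_one, ringKrullDim_fin, add_zero]
    rfl

/-! ### Non-liftability. -/

theorem var_two_notMem : var k 2 ∉ Ideal.span {var k 0, var k 1} ⊔ maximalIdeal (R k) ^ 2 := by
  intro h
  let π := algebraMap (S k) (R k)
  have hπ : Function.Surjective π := Ideal.Quotient.mk_surjective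
  have hmap : Ideal.span {var k 0, var k 1} ⊔ maximalIdeal (R k) ^ 2 =
      (axisIdeal k ⊔ maximalIdeal (S k) ^ 2).map π := by
    rw [Ideal.map_sup, Ideal.map_pow, map_maximalIdeal_of_surjective π hπ, Ideal.map_span,
      Set.image_pair]
    rfl
  have hker : RingHom.ker π ≤ maximalIdeal (S k) ^ 2 := by
    change RingHom.ker (Ideal.Quotient.mk _) ≤ _
    rw [Ideal.mk_ker, Ideal.span_singleton_le_iff_mem]
    exact sq_sub_mul_mem_sq_maximalIdeal k
  have hm : maximalIdeal (S k) ≤ axisIdeal k ⊔ Ideal.span {X 2} := by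
    rw [maximalIdeal_eq_span_range_X, Ideal.span_le]
    rintro _ ⟨i, rfl⟩
    fin_cases i
    · exact Ideal.mem_sup_left (Ideal.subset_span (by simp))
    · exact Ideal.mem_sup_left (Ideal.subset_span (by simp))
    · exact Ideal.mem_sup_right (Ideal.subset_span rfl)
  have hm2 : maximalIdeal (S k) ^ 2 ≤ axisIdeal k ⊔ Ideal.span {X 2 ^ 2} := by
    rw [← Ideal.span_singleton_pow]
    exact (Ideal.pow_right_mono hm 2).trans (Ideal.sup_pow_le _ _ 2)
  -- Pulling back to S adds only (f), which lies in 𝔪² ⊆ (x, y) + (z²). As 1 - cz is a unit, z would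
  -- lie in (x, y).
  have h1 : X 2 ∈ axisIdeal k ⊔ Ideal.span {X 2 ^ 2} := by
    have h2 : X 2 ∈ ((axisIdeal k ⊔ maximalIdeal (S k) ^ 2).map π).comap π := hmap ▸ h
    rw [Ideal.comap_map_of_surjective' π hπ] at h2
    exact sup_le (sup_le le_sup_left hm2) (hker.trans hm2) h2
  obtain ⟨a, ha, b, hb, hab⟩ := Submodule.mem_sup.mp h1
  obtain ⟨c, rfl⟩ := Ideal.mem_span_singleton'.mp hb
  have hu : IsUnit (1 - c * X 2) := by
    rw [isUnit_iff_constantCoeff]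
    simp
  have h2 : X 2 ∈ axisIdeal k := by
    rw [← Ideal.mul_unit_mem_iff_mem _ hu]
    convert! ha using 1
    linear_combination -hab
  have h3 := (mem_span_X_image_iff {0, 1} (X 2 : S k)).mp (by
    rwa [Finset.coe_insert, Finset.coe_singleton, Set.image_pair]) (Finsupp.single 2 1) (by simp)
  simp at h3

theorem not_isLiftable_M (Q : Type u) [CommRing Q] [IsRegularLocalRing Q] [Algebra Q (R k)]
    (hq : Function.Surjective (algebraMap Q (R k))) : ¬ IsLiftable Q (R k) (M k) := by
  rintro ⟨L, _, _, ⟨e⟩, hTor⟩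
  let π := algebraMap Q (R k)
  let I := RingHom.ker π
  have hloc : IsLocalHom π := hq.isLocalHom
  choose x hx using fun i ↦ hq (var k i)
  have hxm (i : Fin 3) : x i ∈ maximalIdeal Q := by
    rw [← maximalIdeal_comap π, Ideal.mem_comap]
    exact (hx i).symm ▸ var_mem_maximalIdeal k i
  have hker : RingHom.ker (algebraMap Q (ResidueField (R k))) = maximalIdeal Q := by
    rw [IsScalarTower.algebraMap_eq Q (R k) (ResidueField (R k)), ← RingHom.comap_ker]
    exact (congrArg (Ideal.comap π) ker_residue).trans (maximalIdeal_comap π)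
  have hres (i : Fin 3) : algebraMap Q (ResidueField (R k)) (x i) = 0 := by
    rw [← RingHom.mem_ker, hker]
    exact hxm i
  have hinj : Function.Injective (I.subtype.lTensor L) :=
    I.lTensor_subtype_injective_of_isZero_tor (q := Algebra.linearMap Q (R k)) hq rfl
      (hTor 1 one_pos)
  have hgen (v : Fin 2 → R k) : ∃ l : L, e (1 ⊗ₜ l) = Submodule.Quotient.mk v := by
    obtain ⟨l, hl⟩ := TensorProduct.mk_surjective Q L (R k) hq (e.symm (Submodule.Quotient.mk v))
    exact ⟨l, by rw [← TensorProduct.mk_apply, hl, e.apply_symm_apply]⟩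
  obtain ⟨e₁, he₁⟩ := hgen ![1, 0]
  obtain ⟨e₂, he₂⟩ := hgen ![0, 1]
  have hsmul (a : Q) (l : L) : (1 : R k) ⊗ₜ[Q] (a • l) = π a • ((1 : R k) ⊗ₜ[Q] l) := by
    rw [TensorProduct.tmul_smul, algebraMap_smul]
  have hrel (a b : Q) (l : Fin 4) (h : (d₁ k).col l = ![π a, π b]) :
      (1 : R k) ⊗ₜ[Q] (a • e₁ + b • e₂) = 0 := by
    apply e.injective
    rw [TensorProduct.tmul_add, hsmul, hsmul, map_add, map_smul, map_smul, he₁, he₂, map_zero]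
    refine (Submodule.Quotient.mk_eq_zero _).mpr ⟨Pi.single l 1, ?_⟩
    rw [Matrix.mulVecLin_apply, Matrix.mulVec_single_one, h]
    ext i
    fin_cases i <;> simp
  have h₁ := hrel (x 0) (x 1) 0 (by ext i; fin_cases i <;> simp [d₁, π, hx])
  have h₂ := hrel 0 (x 0) 1 (by ext i; fin_cases i <;> simp [d₁, π, hx])
  have h₃ := hrel (x 2) (x 1) 2 (by ext i; fin_cases i <;> simp [d₁, π, hx])
  have h₄ := hrel (x 1) 0 3 (by ext i; fin_cases i <;> simp [d₁, π, hx])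
  rw [zero_smul, zero_add] at h₂
  rw [zero_smul, add_zero] at h₄
  -- `coordM` is well defined because the first row of `d₁` lies in the maximal ideal; pulled back
  -- to L it sends e₁ to 1.
  let φ : L →ₗ[Q] ResidueField (R k) :=
    ((coordM k ∘ₗ e.toLinearMap).restrictScalars Q) ∘ₗ TensorProduct.mk Q (R k) L 1
  have hφ : φ e₁ = 1 := by
    change coordM k (e (1 ⊗ₜ e₁)) = 1
    rw [he₁, coordM_mk]
    simp
  have hf : x 2 ^ 2 - x 0 * x 1 ∈ I := by
    rw [RingHom.mem_ker, map_sub, map_pow, map_mul, hx, hx, hx, var_two_sq, sub_self]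
  have hκ : Function.Surjective (algebraMap Q (ResidueField (R k))) := by
    rw [IsScalarTower.algebraMap_eq Q (R k) (ResidueField (R k))]
    exact residue_surjective.comp hq
  have hmem := sq_sub_mul_mem_of_relations hinj hq rfl hκ φ hφ (hres 0)
    (hres 1) (hres 2) hf h₁ h₂ h₃ h₄
  rw [hker] at hmem
  have hm : maximalIdeal Q ≤ I ⊔ Ideal.span {x 0, x 1} ⊔ Ideal.span {x 2} := by
    intro a ha
    have h1 : π a ∈ (Ideal.span {x 0, x 1} ⊔ Ideal.span {x 2}).map π := by
      have : (Ideal.span {x 0, x 1} ⊔ Ideal.span {x 2}).map π = maximalIdeal (R k) := by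
        rw [maximalIdeal_R, ← Ideal.span_union, Ideal.map_span]
        congr 1
        ext b
        simp [Fin.exists_fin_succ, Set.image_insert_eq, π, hx, eq_comm]
        tauto
      rw [this, ← map_maximalIdeal_of_surjective π hq]
      exact Ideal.mem_map_of_mem π ha
    have h2 : a ∈ ((Ideal.span {x 0, x 1} ⊔ Ideal.span {x 2}).map π).comap π := h1
    rw [Ideal.comap_map_of_surjective' π hq] at h2
    rwa [sup_assoc, sup_comm]
  have hz := IsRegularLocalRing.mem_of_sq_sub_mul_mem (I := I)
    (le_maximalIdeal (RingHom.ker_ne_top π)) (hxm 0) (hxm 1) (hxm 2) hm hmem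
  refine var_two_notMem k ?_
  have hz' := Ideal.mem_map_of_mem π hz
  rwa [Ideal.map_sup, Ideal.map_sup, (Ideal.map_eq_bot_iff_le_ker π).mpr le_rfl, bot_sup_eq,
    Ideal.map_pow, map_maximalIdeal_of_surjective π hq, Ideal.map_span, Set.image_pair, hx, hx,
    hx] at hz'

end SerreLifting

theorem mainTheorem5 (k : Type u) [Field k] :
    IsFiniteLength (SerreLifting.R k) (SerreLifting.M k) ∧
    CategoryTheory.projectiveDimension
      (ModuleCat.of (SerreLifting.R k) (SerreLifting.M k)) = 2 ∧
    SerreLifting.IsSerreLiftable (SerreLifting.S k) (SerreLifting.R k) (SerreLifting.M k) ∧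
    ∀ (Q : Type u) [CommRing Q] [IsRegularLocalRing Q] [Algebra Q (SerreLifting.R k)],
      Function.Surjective (algebraMap Q (SerreLifting.R k)) →
        ¬ SerreLifting.IsLiftable Q (SerreLifting.R k) (SerreLifting.M k) :=
  ⟨SerreLifting.isFiniteLength_M k, SerreLifting.projectiveDimension_M k,
    SerreLifting.isSerreLiftable_M k, fun Q _ _ _ hq ↦ SerreLifting.not_isLiftable_M k Q hq⟩
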